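/- Let $K$ be a field, and let $f(X,Y)=\sum_{i=0}^{n}a_iY^i$ and $g(X,Y)=\sum_{i=0}^{m}b_iY^i$ be polynomials in $K[X,Y]$ with $n,m\ge 1$, $a_0,\dots,a_n,b_0,\dots,b_m\in K[X]$ and $a_0a_nb_0b_m\neq 0$. Assume that $f$ and $g$ have no nonconstant factors in $K[X]$. Let $k$ be a positive integer, and let $$A=\deg a_0-\max\{\deg a_1,\dots,\deg a_n\},\qquad B=\max\{\deg b_0,\dots,\deg b_{m-1}\}-\deg b_m .$$ Assume that $\min\{A,\frac{A}{n}\}>\max\{B,\frac{B}{m}\}$ and that $\min\{\deg a_0,\deg b_m\}>\delta_k$, where $\mathrm{Res}_Y(f,g)\in K[X]$ is the resultant of $f$ and $g$ as polynomials in $Y$ and $$\delta_k=\max\Big\{\deg d:\ d\in K[X],\ d\mid \mathrm{Res}_Y(f,g)\ \text{ and }\ \deg d\le \frac{\deg \mathrm{Res}_Y(f,g)}{k+1}\Big\}$$ (here, should $d$ or $\mathrm{Res}_Y(f,g)$ be the zero polynomial, its degree is read as $0$). Then $\mathrm{Res}_Y(f,g)\neq 0$, and each one of the polynomials $f$ and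 $g$ is a product of at most $k$ irreducible factors in $K[X,Y]$, counted with multiplicity. -/

import Mathlib

open scoped Polynomial Polynomial.Bivariate

namespace BivariatePairs

/-- `f ∈ K[X,Y]` has no nonconstant factor in `K[X]`. Here `K[X][Y]` is the ring of polynomials in
`Y` over `K[X]`, and `Polynomial.C` is the inclusion of `K[X]` in it. -/
def NoFactorInX {K : Type*} [Field K] (f : K[X][Y]) : Prop :=
  ∀ p : K[X], Polynomial.C p ∣ f → p.natDegree = 0

/-- The quantity `A = deg a₀ - max {deg a₁, …, deg aₙ}` of `f = ∑ aᵢ Yⁱ`, `n = deg_Y f ≥ 1`.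
Zero coefficients do not affect the maximum, because `aₙ ≠ 0`. -/
noncomputable def degA {K : Type*} [Field K] (f : K[X][Y]) : ℤ :=
  ((f.coeff 0).natDegree : ℤ) -
    (((Finset.Icc 1 f.natDegree).sup fun i => (f.coeff i).natDegree : ℕ) : ℤ)

/-- The quantity `B = max {deg b₀, …, deg bₘ₋₁} - deg bₘ` of `g = ∑ bᵢ Yⁱ`, `m = deg_Y g ≥ 1`.
Zero coefficients do not affect the maximum if `b₀ ≠ 0`. -/
noncomputable def degB {K : Type*} [Field K] (g : K[X][Y]) : ℤ :=
  (((Finset.range g.natDegree).sup fun i => (g.coeff i).natDegree : ℕ) : ℤ) -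
    ((g.coeff g.natDegree).natDegree : ℤ)

/-- The degrees `deg d` of the divisors `d` of `Res_Y(f,g)` with
`deg d ≤ deg Res_Y(f,g) / (k + 1)`. -/
def divisorDegrees {K : Type*} [Field K] (f g : K[X][Y]) (k : ℕ) : Set ℕ :=
  {e | ∃ d : K[X], d ∣ Polynomial.resultant f g ∧ d.natDegree = e ∧
    (d.natDegree : ℚ) ≤ ((Polynomial.resultant f g).natDegree : ℚ) / ((k : ℚ) + 1)}

/-- `δ_k`, the maximum of `divisorDegrees f g k`. -/
noncomputable def delta {K : Type*} [Field K] (f g : K[X][Y]) (k : ℕ) : ℕ :=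
  sSup (divisorDegrees f g k)

/-- The supremum that defines `δ_k` is a maximum. -/
theorem isGreatest_delta {K : Type*} [Field K] (f g : K[X][Y]) (k : ℕ) :
    IsGreatest (divisorDegrees f g k) (delta f g k) := by
  have hne : (divisorDegrees f g k).Nonempty :=
    ⟨0, 1, one_dvd _, by simp, by simp only [Polynomial.natDegree_one]; positivity⟩
  have hb : BddAbove (divisorDegrees f g k) := by
    refine ⟨(Polynomial.resultant f g).natDegree, ?_⟩
    rintro e ⟨d, -, rfl, h⟩
    have h2 : ((Polynomial.resultant f g).natDegree : ℚ) / ((k : ℚ) + 1) ≤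
        ((Polynomial.resultant f g).natDegree : ℚ) :=
      div_le_self (by positivity) (by linarith [(Nat.cast_nonneg k : (0 : ℚ) ≤ k)])
    exact_mod_cast h.trans h2
  exact ⟨Nat.sSup_mem hne hb, fun e he => le_csSup hb he⟩

/-- `f` is a product of at most `k` irreducible factors in `K[X,Y]`, counted with multiplicity. -/
def IsProdOfAtMost {K : Type*} [Field K] (k : ℕ) (f : K[X][Y]) : Prop :=
  ∃ s : Multiset K[X][Y], s.card ≤ k ∧ (∀ p ∈ s, Irreducible p) ∧ s.prod = f

end BivariatePairs

/-!
Fix `t : ℚ` and give the monomial `X ^ a * Y ^ i` the weight `a + i * t`. The hypothesis on `A` and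
`B` leaves room for a `t` such that, for this weight, the coefficient `a₀` strictly dominates all
other terms of `f`, and the term `bₘ Yᵐ` strictly dominates all other terms of `g`
(`IsDominatedAt`). The leading form of a product is the product of the leading forms, so every
factor of `f` is again dominated by its constant term, and every factor of `g` by its top term
(`IsDominatedAt.exists_of_mul`).

If `p` is dominated by its constant term and `q` by its top term, then the diagonal of the Sylvester
matrix of `q` and `p` contributes the unique term of largest degree to the determinant
(`natDegree_det_of_dominant_diagonal`), so that `Res_Y(p, q) ≠ 0` and
`deg Res_Y(p, q) = deg_Y q * deg p₀ + deg_Y p * deg (lc q)` (`natDegree_resultant_of_isDominatedAt`).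

An irreducible factor `p` of `f` has positive degree in `Y`, since `f` has no factor in `K[X]`.
Hence `Res_Y(p, g)` has degree at least `deg bₘ > δ_k`, and as it divides `Res_Y(f, g)` its degree
exceeds `deg Res_Y(f, g) / (k + 1)`. These degrees add up to `deg Res_Y(f, g)`, so there are at
most `k` factors (`isProdOfAtMost_of_multiplicative`). The factors of `g` are treated in the same
way, with `deg a₀` in place of `deg bₘ`.
-/

namespace BivariatePairs

open Polynomial

variable {K : Type*} [Field K]

/-! ### Sums and determinants with a dominant term -/

theorem natDegree_sum_of_dominant {ι : Type*} [DecidableEq ι] (s : Finset ι) (F : ι → K[X]) {a : ι}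
    (ha : a ∈ s) (h0 : F a ≠ 0)
    (h : ∀ i ∈ s, i ≠ a → F i ≠ 0 → (F i).natDegree < (F a).natDegree) :
    ∑ i ∈ s, F i ≠ 0 ∧ (∑ i ∈ s, F i).natDegree = (F a).natDegree := by
  have hlt : (∑ i ∈ s.erase a, F i).degree < (F a).degree := by
    refine (degree_sum_le _ _).trans_lt ?_
    rw [Finset.sup_lt_iff (bot_lt_iff_ne_bot.2 (degree_ne_bot.2 h0))]
    intro i hi
    by_cases hz : F i = 0
    · rw [hz, degree_zero]
      exact bot_lt_iff_ne_bot.2 (degree_ne_bot.2 h0)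
    · exact degree_lt_degree (h i (Finset.mem_of_mem_erase hi) (Finset.ne_of_mem_erase hi) hz)
  have hdeg : (∑ i ∈ s, F i).degree = (F a).degree := by
    rw [← Finset.add_sum_erase s F ha]
    exact degree_add_eq_left_of_degree_lt hlt
  exact ⟨fun hz => h0 (degree_eq_bot.1 (by rw [← hdeg, hz, degree_zero])),
    natDegree_eq_of_degree_eq hdeg⟩

/-- If, up to a rescaling of the rows and columns by the weights `w`, the diagonal entry of each
column has strictly larger degree than the other entries, then the diagonal gives the leading term
of the determinant. -/
theorem natDegree_det_of_dominant_diagonal {ι : Type*} [Fintype ι] [DecidableEq ι]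
    (M : Matrix ι ι K[X]) (w : ι → ℚ) (hd : ∀ j, M j j ≠ 0)
    (h : ∀ i j, i ≠ j → M i j ≠ 0 →
      ((M i j).natDegree : ℚ) + w i < ((M j j).natDegree : ℚ) + w j) :
    M.det ≠ 0 ∧ M.det.natDegree = ∑ j, (M j j).natDegree := by
  have hterm : ∀ σ : Equiv.Perm ι,
      (Equiv.Perm.sign σ • ∏ j, M (σ j) j).natDegree = (∏ j, M (σ j) j).natDegree := by
    intro σ
    rcases Int.units_eq_one_or (Equiv.Perm.sign σ) with hs | hs <;> simp [hs]
  have hone : (∏ j, M j j).natDegree = ∑ j, (M j j).natDegree :=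
    natDegree_prod _ _ fun j _ => hd j
  have key := natDegree_sum_of_dominant (Finset.univ : Finset (Equiv.Perm ι))
    (fun σ => Equiv.Perm.sign σ • ∏ j, M (σ j) j) (a := 1) (Finset.mem_univ _)
    (by simpa [Finset.prod_eq_zero_iff] using hd) ?_
  · rw [Matrix.det_apply]
    refine ⟨key.1, key.2.trans ?_⟩
    simpa using hone
  · intro σ _ hσ hne
    have hprod : ∏ j, M (σ j) j ≠ 0 := fun hz => hne (by rw [hz, smul_zero])
    have hent : ∀ j, M (σ j) j ≠ 0 := fun j => Finset.prod_ne_zero_iff.1 hprod j (Finset.mem_univ j)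
    obtain ⟨j₀, hj₀⟩ : ∃ j, σ j ≠ j := by
      by_contra! hc
      exact hσ (Equiv.ext hc)
    have hsum : ∑ j, (((M (σ j) j).natDegree : ℚ) + w (σ j)) <
        ∑ j, (((M j j).natDegree : ℚ) + w j) := by
      refine Finset.sum_lt_sum (fun j _ => ?_) ⟨j₀, Finset.mem_univ _, h _ _ hj₀ (hent j₀)⟩
      by_cases hj : σ j = j
      · rw [hj]
      · exact (h _ _ hj (hent j)).le
    rw [Finset.sum_add_distrib, Finset.sum_add_distrib, Equiv.sum_comp σ w] at hsum
    have hsum' : ∑ j, (M (σ j) j).natDegree < ∑ j, (M j j).natDegree := by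
      exact_mod_cast lt_of_add_lt_add_right hsum
    rw [hterm, hterm, natDegree_prod _ _ fun j _ => hent j]
    exact hsum'.trans_eq hone.symm

/-! ### Polynomials with a dominant term -/

/-- For the weight giving `X ^ a * Y ^ i` weight `a + i * t`, the term of degree `e` in `Y` is
nonzero and has strictly larger weight than every other nonzero term of `p`. -/
def IsDominatedAt (t : ℚ) (e : ℕ) (p : K[X][Y]) : Prop :=
  p.coeff e ≠ 0 ∧ ∀ i, i ≠ e → p.coeff i ≠ 0 →
    ((p.coeff i).natDegree : ℚ) + i * t < ((p.coeff e).natDegree : ℚ) + e * t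

/-- The term of degree `a` in `Y` is nonzero and of maximal weight in `p`, and among the terms of
maximal weight it has the largest exponent of `Y` if `s > 0`, the smallest if `s < 0`. -/
def IsExtremalAt (t : ℚ) (s : ℤ) (a : ℕ) (p : K[X][Y]) : Prop :=
  p.coeff a ≠ 0 ∧ ∀ i, p.coeff i ≠ 0 →
    ((p.coeff i).natDegree : ℚ) + i * t < ((p.coeff a).natDegree : ℚ) + a * t ∨
    ((p.coeff i).natDegree : ℚ) + i * t = ((p.coeff a).natDegree : ℚ) + a * t ∧ s * i ≤ s * a

theorem exists_isExtremalAt (t : ℚ) (s : ℤ) {p : K[X][Y]} (hp : p ≠ 0) :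
    ∃ a, IsExtremalAt t s a p := by
  obtain ⟨a, ha, hmax⟩ := p.support.exists_max_image
    (fun i => toLex (((p.coeff i).natDegree : ℚ) + i * t, s * (i : ℤ)))
    (nonempty_support_iff.2 hp)
  refine ⟨a, mem_support_iff.1 ha, fun i hi => ?_⟩
  simpa [Prod.Lex.toLex_le_toLex] using hmax i (mem_support_iff.2 hi)

/-- Extremal terms of `p` and `q` multiply without cancellation: any other product of terms with the
same exponent of `Y` has smaller weight, because ties in weight are broken by the exponent. -/
theorem natDegree_coeff_mul_of_isExtremalAt {t : ℚ} {s : ℤ} (hs : s ≠ 0) {p q : K[X][Y]} {a b : ℕ}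
    (hp : IsExtremalAt t s a p) (hq : IsExtremalAt t s b q) :
    (p * q).coeff (a + b) ≠ 0 ∧
      ((p * q).coeff (a + b)).natDegree = (p.coeff a).natDegree + (q.coeff b).natDegree := by
  obtain ⟨ha, hpa⟩ := hp
  obtain ⟨hb, hqb⟩ := hq
  rw [coeff_mul]
  have key := natDegree_sum_of_dominant (Finset.HasAntidiagonal.antidiagonal (a + b))
    (fun x => p.coeff x.1 * q.coeff x.2) (a := (a, b)) (by simp) (mul_ne_zero ha hb) ?_
  · exact ⟨key.1, key.2.trans (natDegree_mul ha hb)⟩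
  · rintro ⟨i, j⟩ hij hne hz
    have hsum : i + j = a + b := by simpa using hij
    have hi : p.coeff i ≠ 0 := left_ne_zero_of_mul hz
    have hj : q.coeff j ≠ 0 := right_ne_zero_of_mul hz
    have hsumQ : (i : ℚ) + j = a + b := by exact_mod_cast hsum
    have hsumZ : s * (i : ℤ) + s * j = s * a + s * b := by
      have : (i : ℤ) + j = a + b := by exact_mod_cast hsum
      rw [← mul_add, this, mul_add]
    have hsumt : (i : ℚ) * t + j * t = a * t + b * t := by rw [← add_mul, hsumQ, add_mul]
    simp only
    rw [natDegree_mul hi hj, natDegree_mul ha hb]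
    have : ((p.coeff i).natDegree : ℚ) + (q.coeff j).natDegree <
        (p.coeff a).natDegree + (q.coeff b).natDegree := by
      rcases hpa i hi with h1 | ⟨h1, h1'⟩ <;> rcases hqb j hj with h2 | ⟨h2, h2'⟩
      · linarith
      · linarith
      · linarith
      · exfalso
        have hia : (i : ℤ) = a := mul_left_cancel₀ hs (by linarith)
        have hia' : i = a := by exact_mod_cast hia
        exact hne (by rw [hia', show j = b by omega])
    exact_mod_cast this

/-- If a product has a strictly dominant term, so has each factor. -/
theorem IsDominatedAt.exists_of_mul {t : ℚ} {e : ℕ} {p q : K[X][Y]}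
    (h : IsDominatedAt t e (p * q)) :
    ∃ a b, a + b = e ∧ IsDominatedAt t a p ∧ IsDominatedAt t b q := by
  have hpq : p * q ≠ 0 := fun hz => h.1 (by simp [hz])
  have hp := left_ne_zero_of_mul hpq
  have hq := right_ne_zero_of_mul hpq
  obtain ⟨a, hpa⟩ := exists_isExtremalAt t 1 hp
  obtain ⟨b, hqb⟩ := exists_isExtremalAt t 1 hq
  obtain ⟨a', hpa'⟩ := exists_isExtremalAt t (-1) hp
  obtain ⟨b', hqb'⟩ := exists_isExtremalAt t (-1) hq
  -- A product of two extremal terms has the maximal weight in `p * q`, hence sits at `e`.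
  have hext : ∀ {x y : ℕ} {s : ℤ}, s ≠ 0 → IsExtremalAt t s x p → IsExtremalAt t s y q →
      x + y = e := by
    intro x y s hs hpx hqy
    obtain ⟨hne, hdeg⟩ := natDegree_coeff_mul_of_isExtremalAt hs hpx hqy
    by_contra hxy
    have hlt := h.2 _ hxy hne
    -- Some product contributing to the coefficient at `e` has at least its degree, although its
    -- weight is at most the maximal one.
    obtain ⟨⟨i, j⟩, hij, hle⟩ : ∃ z ∈ Finset.HasAntidiagonal.antidiagonal e,
        p.coeff z.1 * q.coeff z.2 ≠ 0 ∧
        ((p * q).coeff e).natDegree ≤ (p.coeff z.1 * q.coeff z.2).natDegree := by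
      by_contra! hc
      have hD := h.1
      have hlt' : ((p * q).coeff e).degree < ((p * q).coeff e).degree := by
        nth_rewrite 1 [coeff_mul]
        refine (degree_sum_le _ _).trans_lt ?_
        rw [Finset.sup_lt_iff (bot_lt_iff_ne_bot.2 (degree_ne_bot.2 hD))]
        intro z hz
        by_cases hz0 : p.coeff z.1 * q.coeff z.2 = 0
        · rw [hz0, degree_zero]
          exact bot_lt_iff_ne_bot.2 (degree_ne_bot.2 hD)
        · exact degree_lt_degree (hc z hz hz0)
      exact lt_irrefl _ hlt'
    have hsum : (i : ℚ) + j = e := by exact_mod_cast Finset.HasAntidiagonal.mem_antidiagonal.1 hij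
    have hi : p.coeff i ≠ 0 := left_ne_zero_of_mul hle.1
    have hj : q.coeff j ≠ 0 := right_ne_zero_of_mul hle.1
    have hle' : (((p * q).coeff e).natDegree : ℚ) ≤
        (p.coeff i).natDegree + (q.coeff j).natDegree := by
      have := hle.2
      simp only at this
      rw [natDegree_mul hi hj] at this
      exact_mod_cast this
    have h1 := (hpx.2 i hi).elim le_of_lt fun h => h.1.le
    have h2 := (hqy.2 j hj).elim le_of_lt fun h => h.1.le
    rw [hdeg, ← hsum] at hlt
    push_cast at hlt
    linarith
  have hab := hext one_ne_zero hpa hqb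
  have hab' := hext (by norm_num) hpa' hqb'
  obtain ⟨ha, hpa⟩ := hpa
  obtain ⟨hb, hqb⟩ := hqb
  obtain ⟨ha', hpa'⟩ := hpa'
  obtain ⟨hb', hqb'⟩ := hqb'
  -- The largest and the smallest index of maximal weight coincide, so the maximum is strict.
  have haa' : a' ≤ a := by
    rcases hpa a' ha' with h1 | h1 <;> rcases hpa' a ha with h2 | h2
    · linarith
    · linarith
    · linarith
    · omega
  have hbb' : b' ≤ b := by
    rcases hqb b' hb' with h1 | h1 <;> rcases hqb' b hb with h2 | h2
    · linarith
    · linarith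
    · linarith
    · omega
  obtain rfl : a' = a := by omega
  obtain rfl : b' = b := by omega
  refine ⟨a', b', hab, ⟨ha, fun i hi hi0 => ?_⟩, ⟨hb, fun i hi hi0 => ?_⟩⟩
  · rcases hpa i hi0 with h1 | h1
    · exact h1
    · rcases hpa' i hi0 with h2 | h2
      · exact h2
      · omega
  · rcases hqb i hi0 with h1 | h1
    · exact h1
    · rcases hqb' i hi0 with h2 | h2
      · exact h2
      · omega

theorem IsDominatedAt.zero_of_dvd {t : ℚ} {p f : K[X][Y]} (h : IsDominatedAt t 0 f)
    (hpf : p ∣ f) : IsDominatedAt t 0 p := by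
  obtain ⟨q, rfl⟩ := hpf
  obtain ⟨a, b, hab, ha, -⟩ := h.exists_of_mul
  obtain rfl : a = 0 := by omega
  exact ha

theorem IsDominatedAt.natDegree_of_dvd {t : ℚ} {p f : K[X][Y]}
    (h : IsDominatedAt t f.natDegree f) (hpf : p ∣ f) : IsDominatedAt t p.natDegree p := by
  obtain ⟨q, rfl⟩ := hpf
  have hpq : p * q ≠ 0 := fun hz => h.1 (by simp [hz])
  obtain ⟨a, b, hab, ha, hb⟩ := h.exists_of_mul
  rw [natDegree_mul (left_ne_zero_of_mul hpq) (right_ne_zero_of_mul hpq)] at hab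
  have h1 := le_natDegree_of_ne_zero ha.1
  have h2 := le_natDegree_of_ne_zero hb.1
  obtain rfl : a = p.natDegree := by omega
  exact ha

/-! ### The degree of the resultant -/

theorem natDegree_resultant_of_isDominatedAt {t : ℚ} {f g : K[X][Y]} (hf : IsDominatedAt t 0 f)
    (hg : IsDominatedAt t g.natDegree g) :
    resultant f g ≠ 0 ∧ (resultant f g).natDegree =
      g.natDegree * (f.coeff 0).natDegree + f.natDegree * g.leadingCoeff.natDegree := by
  -- In the Sylvester matrix of `g` and `f`, in this order, the diagonal entries are `f.coeff 0`
  -- and the leading coefficient of `g`.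
  have key : resultant g f ≠ 0 ∧ (resultant g f).natDegree =
      g.natDegree * (f.coeff 0).natDegree + f.natDegree * g.leadingCoeff.natDegree := by
    have hL : ∀ j : Fin g.natDegree, sylvester g f g.natDegree f.natDegree
        (Fin.castAdd _ j) (Fin.castAdd _ j) = f.coeff 0 := by
      intro j; simp [sylvester]
    have hR : ∀ j : Fin f.natDegree, sylvester g f g.natDegree f.natDegree
        (Fin.natAdd _ j) (Fin.natAdd _ j) = g.leadingCoeff := by
      intro j
      simp only [sylvester, Matrix.of_apply, Fin.addCases_right, Fin.val_natAdd]
      rw [if_pos ⟨by omega, by omega⟩, Nat.add_sub_cancel, leadingCoeff]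
    have hdet := natDegree_det_of_dominant_diagonal (sylvester g f g.natDegree f.natDegree)
      (fun i => (i : ℕ) * t) ?_ ?_
    · refine ⟨hdet.1, hdet.2.trans ?_⟩
      rw [Fin.sum_univ_add]
      simp [hL, hR]
    · intro j
      induction j using Fin.addCases with
      | left j => rw [hL]; exact hf.1
      | right j => rw [hR]; exact hg.1
    · intro i j hij hne
      have hij' : (i : ℕ) ≠ j := fun h => hij (Fin.ext h)
      induction j using Fin.addCases with
      | left j =>
        rw [hL]
        simp only [sylvester, Matrix.of_apply, Fin.addCases_left, Fin.val_castAdd] at hne hij' ⊢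
        split_ifs at hne ⊢ with hmem
        · have := hf.2 _ (by have := hmem.1; omega) hne
          rw [Nat.cast_sub hmem.1] at this
          push_cast at this
          linarith
        · exact absurd rfl hne
      | right j =>
        rw [hR]
        simp only [sylvester, Matrix.of_apply, Fin.addCases_right, Fin.val_natAdd] at hne hij' ⊢
        split_ifs at hne ⊢ with hmem
        · have := hg.2 _ (by have := hmem.1; omega) hne
          rw [Nat.cast_sub hmem.1] at this
          push_cast at this ⊢
          rw [leadingCoeff]
          linarith
        · exact absurd rfl hne
  rw [resultant_comm]
  rcases neg_one_pow_eq_or K[X] (f.natDegree * g.natDegree) with h | h <;> simpa [h] using key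

/-! ### Counting factors -/

theorem natDegree_pos_of_irreducible_of_dvd {f p : K[X][Y]} (hf : NoFactorInX f)
    (hp : Irreducible p) (hpf : p ∣ f) : 1 ≤ p.natDegree := by
  by_contra! hlt
  obtain ⟨c, rfl⟩ : ∃ c, C c = p := ⟨_, (eq_C_of_natDegree_eq_zero (by omega)).symm⟩
  obtain ⟨u, rfl⟩ : ∃ u, C u = c := ⟨_, (eq_C_of_natDegree_eq_zero (hf c hpf)).symm⟩
  have hu : u ≠ 0 := fun h => hp.ne_zero (by simp [h])
  exact hp.not_isUnit ((IsUnit.mk0 u hu).map (C.comp C : K →+* K[X][Y]))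

/-- If the multiplicative map `R` sends every irreducible factor of `f` to a polynomial of degree
more than `deg (R f) / (k + 1)`, then `f` has at most `k` irreducible factors. -/
theorem isProdOfAtMost_of_multiplicative {f : K[X][Y]} {k : ℕ} (R : K[X][Y] → K[X])
    (hR1 : R 1 = 1) (hRmul : ∀ p q, p ≠ 0 → q ≠ 0 → R (p * q) = R p * R q)
    (hf0 : f ≠ 0) (hfu : ¬IsUnit f) (hRf : R f ≠ 0)
    (h : ∀ p, Irreducible p → p ∣ f → R p ∣ R f →
      (R f).natDegree < (k + 1) * (R p).natDegree) :
    IsProdOfAtMost k f := by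
  obtain ⟨s, hs, rfl, -⟩ := (WfDvdMonoid.not_isUnit_iff_exists_factors_eq f hf0).1 hfu
  refine ⟨s, ?_, hs, rfl⟩
  have hprod : ∀ s : Multiset K[X][Y], (∀ p ∈ s, Irreducible p) → R s.prod = (s.map R).prod := by
    intro s
    induction s using Multiset.induction with
    | empty => simp [hR1]
    | cons p s ih =>
      intro hs
      have hs' : ∀ q ∈ s, Irreducible q := fun q hq => hs q (Multiset.mem_cons_of_mem hq)
      rw [Multiset.prod_cons, Multiset.map_cons, Multiset.prod_cons,
        hRmul _ _ (hs p (Multiset.mem_cons_self _ _)).ne_zero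
          (Multiset.prod_ne_zero fun h0 => (hs' 0 h0).ne_zero rfl), ih hs']
  have hRs := hprod s hs
  have hdeg : (R s.prod).natDegree = (s.map fun p => (R p).natDegree).sum := by
    rw [hRs, natDegree_multiset_prod, Multiset.map_map]
    · rfl
    · intro h0
      exact hRf (by rw [hRs, Multiset.prod_eq_zero h0])
  by_contra! hcard
  -- Each of the at least `k + 1` summands is at least `(deg (R f) + 1) / (k + 1)`.
  have hsum : s.card • ((R s.prod).natDegree + 1) ≤
      (s.map fun p => (k + 1) * (R p).natDegree).sum := by
    have := Multiset.card_nsmul_le_sum (s := s.map fun p => (k + 1) * (R p).natDegree)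
      (a := (R s.prod).natDegree + 1) ?_
    · simpa using this
    · intro x hx
      obtain ⟨p, hp, rfl⟩ := Multiset.mem_map.1 hx
      refine h p (hs p hp) (Multiset.dvd_prod hp) ?_
      rw [hRs]
      exact Multiset.dvd_prod (Multiset.mem_map_of_mem R hp)
  rw [Multiset.sum_map_mul_left, ← hdeg, smul_eq_mul] at hsum
  nlinarith

theorem natDegree_lt_mul_of_delta_lt {f g : K[X][Y]} {k : ℕ} {d : K[X]} (hd : d ∣ resultant f g)
    (h : delta f g k < d.natDegree) : (resultant f g).natDegree < (k + 1) * d.natDegree := by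
  by_contra! hle
  refine h.not_ge ((isGreatest_delta f g k).2 ⟨d, hd, rfl, ?_⟩)
  rw [le_div_iff₀ (by positivity), mul_comm]
  exact_mod_cast hle

/-! ### The choice of the weight -/

theorem isDominatedAt_zero_of_lt_degA {t : ℚ} {f : K[X][Y]} (hn : 1 ≤ f.natDegree)
    (h0 : f.coeff 0 ≠ 0) (h1 : t < degA f) (h2 : t < (degA f : ℚ) / f.natDegree) :
    IsDominatedAt t 0 f := by
  refine ⟨h0, fun i hi hi0 => ?_⟩
  have hin := le_natDegree_of_ne_zero hi0
  have hsup : (f.coeff i).natDegree ≤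
      (Finset.Icc 1 f.natDegree).sup fun i => (f.coeff i).natDegree :=
    Finset.le_sup (f := fun i => (f.coeff i).natDegree) (by simp; omega)
  have hA : (degA f : ℚ) + (f.coeff i).natDegree ≤ (f.coeff 0).natDegree := by
    have : degA f + (f.coeff i).natDegree ≤ (f.coeff 0).natDegree := by
      unfold degA; omega
    exact_mod_cast this
  have hn' : (0 : ℚ) < f.natDegree := by exact_mod_cast hn
  have hi1 : (1 : ℚ) ≤ i := by exact_mod_cast Nat.one_le_iff_ne_zero.2 hi
  have hin' : (i : ℚ) ≤ f.natDegree := by exact_mod_cast hin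
  rw [lt_div_iff₀ hn'] at h2
  have : (i : ℚ) * t < degA f := by
    rcases le_or_gt 0 t with ht | ht <;> nlinarith
  simp only [Nat.cast_zero, zero_mul, add_zero]
  linarith

theorem isDominatedAt_natDegree_of_degB_lt {t : ℚ} {g : K[X][Y]} (hm : 1 ≤ g.natDegree)
    (h1 : (degB g : ℚ) < t) (h2 : (degB g : ℚ) / g.natDegree < t) :
    IsDominatedAt t g.natDegree g := by
  refine ⟨leadingCoeff_ne_zero.2 fun h => by simp [h] at hm, fun i hi hi0 => ?_⟩
  have hin : i < g.natDegree := lt_of_le_of_ne (le_natDegree_of_ne_zero hi0) hi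
  have hsup : (g.coeff i).natDegree ≤
      (Finset.range g.natDegree).sup fun i => (g.coeff i).natDegree :=
    Finset.le_sup (f := fun i => (g.coeff i).natDegree) (by simpa using hin)
  have hB : ((g.coeff i).natDegree : ℚ) ≤ degB g + (g.coeff g.natDegree).natDegree := by
    have : ((g.coeff i).natDegree : ℤ) ≤ degB g + (g.coeff g.natDegree).natDegree := by
      unfold degB; omega
    exact_mod_cast this
  have hm' : (0 : ℚ) < g.natDegree := by exact_mod_cast hm
  have hi1 : (i : ℚ) + 1 ≤ g.natDegree := by exact_mod_cast hin
  have hi2 : (0 : ℚ) ≤ i := Nat.cast_nonneg i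
  rw [div_lt_iff₀ hm'] at h2
  have : (degB g : ℚ) < (g.natDegree - i) * t := by
    rcases le_or_gt 0 t with ht | ht <;> nlinarith
  linarith

end BivariatePairs

theorem theorem6p1 {K : Type*} [Field K] (f g : K[X][Y]) (k : ℕ) (hk : 1 ≤ k)
    (hn : 1 ≤ f.natDegree) (hm : 1 ≤ g.natDegree)
    (ha : f.coeff 0 ≠ 0) (hb : g.coeff 0 ≠ 0)
    (hf : BivariatePairs.NoFactorInX f) (hg : BivariatePairs.NoFactorInX g)
    (hAB : max (BivariatePairs.degB g : ℚ) ((BivariatePairs.degB g : ℚ) / (g.natDegree : ℚ)) <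
      min (BivariatePairs.degA f : ℚ) ((BivariatePairs.degA f : ℚ) / (f.natDegree : ℚ)))
    (hdelta : BivariatePairs.delta f g k <
      min (f.coeff 0).natDegree (g.coeff g.natDegree).natDegree) :
    Polynomial.resultant f g ≠ 0 ∧
      BivariatePairs.IsProdOfAtMost k f ∧ BivariatePairs.IsProdOfAtMost k g := by
  open Polynomial BivariatePairs in
  obtain ⟨t, hBt, htA⟩ := exists_between hAB
  have hdf := isDominatedAt_zero_of_lt_degA hn ha (lt_min_iff.1 htA).1 (lt_min_iff.1 htA).2
  have hdg := isDominatedAt_natDegree_of_degB_lt hm (max_lt_iff.1 hBt).1 (max_lt_iff.1 hBt).2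
  have hres := (natDegree_resultant_of_isDominatedAt hdf hdg).1
  have hf0 : f ≠ 0 := fun h => ha (by simp [h])
  have hg0 : g ≠ 0 := fun h => hb (by simp [h])
  have hnu : ∀ h : K[X][Y], 1 ≤ h.natDegree → ¬IsUnit h := fun h hh hu => by
    have := natDegree_eq_zero_of_isUnit hu
    omega
  obtain ⟨hδa, hδb⟩ := lt_min_iff.1 hdelta
  refine ⟨hres, ?_, ?_⟩
  · refine isProdOfAtMost_of_multiplicative (fun p => resultant p g) (by simp) ?_ hf0 (hnu f hn)
      hres fun p hp hpf hdvd => natDegree_lt_mul_of_delta_lt hdvd (hδb.trans_le ?_)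
    · intro p q hp hq
      rw [natDegree_mul hp hq, resultant_mul_left _ _ _ _ le_rfl]
    · rw [(natDegree_resultant_of_isDominatedAt (hdf.zero_of_dvd hpf) hdg).2, leadingCoeff]
      have := Nat.le_mul_of_pos_left (g.coeff g.natDegree).natDegree
        (natDegree_pos_of_irreducible_of_dvd hf hp hpf)
      omega
  · refine isProdOfAtMost_of_multiplicative (fun p => resultant f p) (by simp) ?_ hg0 (hnu g hm)
      hres fun p hp hpg hdvd => natDegree_lt_mul_of_delta_lt hdvd (hδa.trans_le ?_)
    · intro p q hp hq
      rw [natDegree_mul hp hq, resultant_mul_right _ _ _ _ le_rfl]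
    · rw [(natDegree_resultant_of_isDominatedAt hdf (hdg.natDegree_of_dvd hpg)).2]
      have := Nat.le_mul_of_pos_left (f.coeff 0).natDegree
        (natDegree_pos_of_irreducible_of_dvd hg hp hpg)
      omega
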